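/- A metric space $(T,d)$ is a \emph{real tree} if any two points $\sigma,\sigma'$ are joined by an isometric image $[\![\sigma,\sigma']\!]$ of $[0,d(\sigma,\sigma')]$ and every continuous injective $q:[0,1]\to T$ satisfies $q([0,1])=[\![q(0),q(1)]\!]$. Let $(T,d,\rho)$ be a rooted compact real tree with a linear order $\leq$ such that (Or1) $\sigma_1\in[\![\rho,\sigma_2]\!]$ implies $\sigma_1\leq\sigma_2$; (Or2) if $\sigma_1\leq\sigma_2\leq\sigma_3$ and $\gamma$ is given by $[\![\rho,\gamma]\!]=[\![\rho,\sigma_1]\!]\cap([\![\rho,\sigma_2]\!]\cup[\![\rho,\sigma_3]\!])$, then $\gamma\in[\![\rho,\sigma_2]\!]$. A finite Borel measure $\mu$ on $T$ satisfies (Mes) if $\mu(\{\sigma:\sigma_1<\sigma<\sigma_2\})>0$ whenever $\sigma_1<\sigma_2$. A \emph{height function} with lifetime $\zeta(h)=M\geq 0$ is a left-continuous function $h:[0,M]\to[0,\infty)$ with right limits such that $h(0)=h(0+)=0$ and $h(t+)\leq h(t)$ for $t\in[0,M)$. Let $d_h(s,t)=h(s)+h(t)-2\inf_{[s\wedge t,s\vee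 t]}h$, let $T_h$ be the quotient of $[0,M]$ by $d_h=0$ with the induced distance $d_h$, and let $p_h:[0,M]\to T_h$ be the projection, $\rho_h=p_h(0)$, $\ell(\sigma)=\inf p_h^{-1}(\{\sigma\})$ and $r(\sigma)=\inf\{t>\ell(\sigma):p_h(t)\neq\sigma\}$ (equal to $M$ if this set is empty). Put $\sigma\leq_h\sigma'$ iff $\ell(\sigma)\leq\ell(\sigma')$, and let $\mu_h$ be the image of Lebesgue measure on $[0,M]$ under $p_h$. The function $h$ is \emph{minimal} if $[0,M]\setminus\bigcup_{\sigma\in T_h}[\ell(\sigma),r(\sigma)]$ is Lebesgue-null, and $h$ \emph{codes} $(T,d,\rho,\leq,\mu)$ if there is an isometry from $T$ onto $T_h$ that preserves roots, orders and measures. \textbf{Theorem.} Let $\mu,\mu'$ be finite Borel measures on $T$ that both satisfy (Mes), and let $h,h'$ be minimal height functions coding $(T,d,\rho,\leq,\mu)$ and $(T,d,\rho,\leq,\mu')$ respectively. Then $\zeta(h)=\mu(T)$, $\zeta(h')=\mu'(T)$, and there is a non-decreasing left-continuous $\varphi:[0,\mu(T)]\to[0,\mu'(T)]$ with $\varphi(0)=0$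 and $h=h'\circ\varphi$. Moreover: (i) such a $\varphi$ is unique if and only if $\mu(\{\sigma\})\,\mu'(\{\sigma\})=0$ for every $\sigma\in T$; and every such $\varphi$ has the following properties: (ii) if $\mu'$ has no atom, then $\varphi$ is continuous; (iii) if $\mu$ has no atom, then $\varphi$ is strictly increasing; (iv) for every $t\in[0,\zeta(h))$ with $\varphi(t)<\varphi(t+)$, one has $h'(u)=h(t)$ for all $u\in[\varphi(t),\varphi(t+)]$. -/

import Mathlib

open Set Filter Topology MeasureTheory

noncomputable section

/-! ### Rooted real trees -/

/-- `f` restricts to an isometric map of `[0, d(x, y)]` into `T` from `x` to `y`. -/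
def IsGeodesic {T : Type*} [MetricSpace T] (f : ℝ → T) (x y : T) : Prop :=
  f 0 = x ∧ f (dist x y) = y ∧
    ∀ s ∈ Icc 0 (dist x y), ∀ t ∈ Icc 0 (dist x y), dist (f s) (f t) = |s - t|

/-- The arc `⟦x, y⟧`: the points on a geodesic from `x` to `y` (in a real tree all geodesics
from `x` to `y` have the same image). -/
def arc {T : Type*} [MetricSpace T] (x y : T) : Set T :=
  {z | ∃ f : ℝ → T, IsGeodesic f x y ∧ z ∈ f '' Icc 0 (dist x y)}

/-- Real trees: any two points are joined by a geodesic, and every continuous injective path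
has the arc between its endpoints as its image. -/
def IsRealTree (T : Type*) [MetricSpace T] : Prop :=
  (∀ x y : T, ∃ f : ℝ → T, IsGeodesic f x y) ∧
    ∀ q : ℝ → T, ContinuousOn q (Icc 0 1) → InjOn q (Icc 0 1) →
      q '' Icc 0 1 = arc (q 0) (q 1)

/-- (Or1): the linear order extends the genealogical order. -/
def Or1 {T : Type*} [MetricSpace T] [LinearOrder T] (ρ : T) : Prop :=
  ∀ a b : T, a ∈ arc ρ b → a ≤ b

/-- (Or2): if `a ≤ b ≤ c`, the branching point `γ` of `a` on the subtree spanned by `ρ`, `b`, `c`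
lies on `⟦ρ, b⟧`. -/
def Or2 {T : Type*} [MetricSpace T] [LinearOrder T] (ρ : T) : Prop :=
  ∀ a b c : T, a ≤ b → b ≤ c →
    ∀ γ : T, arc ρ γ = arc ρ a ∩ (arc ρ b ∪ arc ρ c) → γ ∈ arc ρ b

/-- (Mes): open intervals between two distinct points are charged. -/
def Mes {T : Type*} [LinearOrder T] [MeasurableSpace T] (μ : Measure T) : Prop :=
  ∀ a b : T, a < b → 0 < μ {c | a < c ∧ c < b}

/-! ### Height functions -/

/-- A height function: a lifetime `M ≥ 0` and a non-negative function `h` on `[0, M]` that is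
left-continuous with right limits, `h(0) = h(0+) = 0`, and `h(t+) ≤ h(t)` on `[0, M)`.
Values outside `[0, M]` are irrelevant. -/
structure HeightFunction where
  lifetime : ℝ
  lifetime_nonneg : 0 ≤ lifetime
  toFun : ℝ → ℝ
  nonneg : ∀ t ∈ Icc 0 lifetime, 0 ≤ toFun t
  zero : toFun 0 = 0
  right_zero : 0 < lifetime → Tendsto toFun (𝓝[>] 0) (𝓝 0)
  left_cont : ∀ t ∈ Ioc 0 lifetime, Tendsto toFun (𝓝[<] t) (𝓝 (toFun t))
  right_lim : ∀ t ∈ Ico 0 lifetime, ∃ l, Tendsto toFun (𝓝[>] t) (𝓝 l) ∧ l ≤ toFun t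

namespace HeightFunction

/-- `m_h(s, t)`, the infimum of `h` between the times `s` and `t`. -/
def infBetween (h : HeightFunction) (s t : ℝ) : ℝ := sInf (h.toFun '' uIcc s t)

/-- `d_h(s, t) = h(s) + h(t) - 2 m_h(s, t)`. -/
def timeDist (h : HeightFunction) (s t : ℝ) : ℝ :=
  h.toFun s + h.toFun t - 2 * h.infBetween s t

theorem infBetween_le (h : HeightFunction) {s t r : ℝ} (hs : s ∈ Icc 0 h.lifetime)
    (ht : t ∈ Icc 0 h.lifetime) (hr : r ∈ uIcc s t) : h.infBetween s t ≤ h.toFun r := by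
  refine csInf_le ⟨0, ?_⟩ ⟨r, hr, rfl⟩
  rintro _ ⟨x, hx, rfl⟩
  exact h.nonneg x (uIcc_subset_Icc hs ht hx)

theorem le_infBetween (h : HeightFunction) {s t c : ℝ}
    (hc : ∀ r ∈ uIcc s t, c ≤ h.toFun r) : c ≤ h.infBetween s t := by
  refine le_csInf ⟨_, s, left_mem_uIcc, rfl⟩ ?_
  rintro _ ⟨x, hx, rfl⟩
  exact hc x hx

/-- The time set `[0, M]`, to be equipped with the pseudo-distance `d_h`. -/
def Time (h : HeightFunction) : Type := {t : ℝ // t ∈ Icc 0 h.lifetime}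

instance (h : HeightFunction) : PseudoMetricSpace h.Time where
  dist s t := h.timeDist s.1 t.1
  dist_self s := by
    simp only [timeDist, infBetween, uIcc_self, image_singleton, csInf_singleton]
    ring
  dist_comm s t := by
    simp only [timeDist, infBetween, uIcc_comm s.1 t.1]
    ring
  dist_triangle s t u := by
    have h1 : h.infBetween s.1 t.1 ≤ h.toFun t.1 := h.infBetween_le s.2 t.2 right_mem_uIcc
    have h2 : h.infBetween t.1 u.1 ≤ h.toFun t.1 := h.infBetween_le t.2 u.2 left_mem_uIcc
    have h3 : min (h.infBetween s.1 t.1) (h.infBetween t.1 u.1) ≤ h.infBetween s.1 u.1 := by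
      refine h.le_infBetween fun r hr => ?_
      rcases uIcc_subset_uIcc_union_uIcc (b := t.1) hr with hr | hr
      · exact (min_le_left _ _).trans (h.infBetween_le s.2 t.2 hr)
      · exact (min_le_right _ _).trans (h.infBetween_le t.2 u.2 hr)
    simp only [timeDist]
    rcases min_choice (h.infBetween s.1 t.1) (h.infBetween t.1 u.1) with h4 | h4 <;>
      rw [h4] at h3 <;> linarith

/-- The coded tree `T_h`: the quotient of `[0, M]` by `d_h(s, t) = 0`, a metric space for the
distance induced by `d_h`. -/
abbrev Tree (h : HeightFunction) : Type := SeparationQuotient h.Time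

instance (h : HeightFunction) : MeasurableSpace h.Tree := borel _

instance (h : HeightFunction) : BorelSpace h.Tree := ⟨rfl⟩

/-- The projection `p_h : [0, M] → T_h`, extended to `ℝ` by constants. -/
def proj (h : HeightFunction) (t : ℝ) : h.Tree :=
  SeparationQuotient.mk (projIcc 0 h.lifetime h.lifetime_nonneg t : Icc 0 h.lifetime)

/-- On `[0, M]`, the distance on the coded tree is the one induced by `d_h`. -/
theorem dist_proj (h : HeightFunction) {s t : ℝ} (hs : s ∈ Icc 0 h.lifetime)
    (ht : t ∈ Icc 0 h.lifetime) : dist (h.proj s) (h.proj t) = h.timeDist s t := by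
  unfold proj
  rw [projIcc_of_mem _ hs, projIcc_of_mem _ ht]
  rfl

theorem proj_tendsto_left (h : HeightFunction) (t : ℝ) :
    Tendsto h.proj (𝓝[<] t) (𝓝 (h.proj t)) := by
  rcases le_or_gt t 0 with h0 | h0
  · refine tendsto_const_nhds.congr' ?_
    filter_upwards [self_mem_nhdsWithin] with s hs
    unfold proj
    rw [projIcc_of_le_left _ h0, projIcc_of_le_left _ (le_of_lt (lt_of_lt_of_le hs h0))]
  rcases le_or_gt t h.lifetime with hM | hM
  · rw [Metric.tendsto_nhds]
    intro ε hε
    have hl := (Metric.tendsto_nhds.1 (h.left_cont t ⟨h0, hM⟩)) (ε / 4) (by positivity)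
    obtain ⟨a, ha, hab⟩ := (mem_nhdsLT_iff_exists_Ioo_subset.1 hl)
    filter_upwards [Ioo_mem_nhdsLT (max_lt ha h0)] with s hs
    have hs' : max a 0 < s ∧ s < t := hs
    have hs0 : a < s ∧ 0 < s := max_lt_iff.1 hs'.1
    have hsI : s ∈ Icc 0 h.lifetime := ⟨hs0.2.le, hs'.2.le.trans hM⟩
    have htI : t ∈ Icc 0 h.lifetime := ⟨h0.le, hM⟩
    rw [h.dist_proj hsI htI]
    have key : ∀ r ∈ Ioo a t, |h.toFun r - h.toFun t| < ε / 4 := fun r hr => hab hr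
    have h1 : h.toFun t - ε / 4 ≤ h.infBetween s t := by
      refine h.le_infBetween fun r hr => ?_
      rw [uIcc_of_le hs'.2.le] at hr
      rcases eq_or_lt_of_le hr.2 with rfl | hlt
      · linarith
      · have := abs_lt.1 (key r ⟨hs0.1.trans_le hr.1, hlt⟩)
        linarith
    have h2 := abs_lt.1 (key s ⟨hs0.1, hs'.2⟩)
    simp only [timeDist]
    linarith
  · refine tendsto_const_nhds.congr' ?_
    filter_upwards [Ioo_mem_nhdsLT hM] with s hs
    unfold proj
    rw [projIcc_of_right_le _ hM.le, projIcc_of_right_le _ (le_of_lt hs.1)]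

theorem measurable_proj (h : HeightFunction) : Measurable h.proj := by
  have hlim : ∀ t : ℝ, Tendsto (fun n : ℕ => ((⌈((n : ℝ) + 1) * t⌉ : ℝ) - 1) / ((n : ℝ) + 1))
      atTop (𝓝[<] t) := by
    intro t
    refine tendsto_nhdsWithin_iff.2 ⟨?_, Eventually.of_forall fun n => ?_⟩
    · have h1 : Tendsto (fun n : ℕ => t - 1 / ((n : ℝ) + 1)) atTop (𝓝 t) := by
        simpa using tendsto_const_nhds.sub (tendsto_one_div_add_atTop_nhds_zero_nat (𝕜 := ℝ))
      refine tendsto_of_tendsto_of_tendsto_of_le_of_le h1 tendsto_const_nhds ?_ ?_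
      · intro n
        have hn : (0 : ℝ) < (n : ℝ) + 1 := by positivity
        change t - 1 / ((n : ℝ) + 1) ≤ _
        rw [le_div_iff₀ hn, sub_mul, div_mul_cancel₀ _ hn.ne']
        have := Int.le_ceil (((n : ℝ) + 1) * t)
        linarith
      · intro n
        have hn : (0 : ℝ) < (n : ℝ) + 1 := by positivity
        change _ ≤ t
        rw [div_le_iff₀ hn]
        have := Int.ceil_lt_add_one (((n : ℝ) + 1) * t)
        linarith
    · have hn : (0 : ℝ) < (n : ℝ) + 1 := by positivity
      change _ < t
      rw [div_lt_iff₀ hn]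
      have := Int.ceil_lt_add_one (((n : ℝ) + 1) * t)
      linarith
  refine measurable_of_tendsto_metrizable
    (f := fun (n : ℕ) (t : ℝ) => h.proj (((⌈((n : ℝ) + 1) * t⌉ : ℝ) - 1) / ((n : ℝ) + 1)))
    (fun n => ?_) (tendsto_pi_nhds.2 fun t => (h.proj_tendsto_left t).comp (hlim t))
  exact (measurable_of_countable
    (fun k : ℤ => h.proj (((k : ℝ) - 1) / ((n : ℝ) + 1)))).comp
      (Int.measurable_ceil.comp (measurable_const.mul measurable_id))

/-- The root `ρ_h = p_h(0)`. -/
def root (h : HeightFunction) : h.Tree := h.proj 0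

/-- `ℓ(σ) = inf p_h⁻¹({σ})`. -/
def firstTime (h : HeightFunction) (σ : h.Tree) : ℝ :=
  sInf {t | t ∈ Icc 0 h.lifetime ∧ h.proj t = σ}

/-- The relation `≤_h` on `T_h`. -/
def TreeLE (h : HeightFunction) (σ τ : h.Tree) : Prop := h.firstTime σ ≤ h.firstTime τ

/-- The measure `μ_h` on `T_h` induced by the Lebesgue measure on `[0, M]`. -/
def treeMeasure (h : HeightFunction) : Measure h.Tree :=
  (volume.restrict (Icc 0 h.lifetime)).map h.proj

theorem treeMeasure_apply (h : HeightFunction) {A : Set h.Tree} (hA : MeasurableSet A) :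
    h.treeMeasure A = volume {t | t ∈ Icc 0 h.lifetime ∧ h.proj t ∈ A} := by
  rw [treeMeasure, Measure.map_apply h.measurable_proj hA,
    Measure.restrict_apply (h.measurable_proj hA)]
  congr 1
  ext t
  exact and_comm

/-- `r(σ) = inf {t > ℓ(σ) : p_h(t) ≠ σ}`, which is `M` if `p_h = σ` on all of `(ℓ(σ), M]`. -/
def exitTime (h : HeightFunction) (σ : h.Tree) : ℝ :=
  sInf (insert h.lifetime {t | t ∈ Icc 0 h.lifetime ∧ h.firstTime σ < t ∧ h.proj t ≠ σ})

/-- `F(h)`, the set of times of first visit. -/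
def firstVisits (h : HeightFunction) : Set ℝ := ⋃ σ : h.Tree, Icc (h.firstTime σ) (h.exitTime σ)

/-- `S(h)`, the set of times of latter visit. -/
def latterVisits (h : HeightFunction) : Set ℝ := Icc 0 h.lifetime \ h.firstVisits

/-- (Min): the set of times of latter visit is Lebesgue-null. -/
def IsMinimal (h : HeightFunction) : Prop := volume h.latterVisits = 0

/-- `h` codes the structured tree `(T, d, ρ, ≤, μ)`: some isometry from `T` onto `T_h` preserves
roots, orders and measures. -/
def Codes (h : HeightFunction) {T : Type*} [MetricSpace T] [LinearOrder T] [MeasurableSpace T]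
    (ρ : T) (μ : Measure T) : Prop :=
  ∃ f : T ≃ᵢ h.Tree, f ρ = h.root ∧ (∀ a b : T, a ≤ b → h.TreeLE (f a) (f b)) ∧
    h.treeMeasure = μ.map f

/-- `φ : [0, ζ(h)] → [0, ζ(h')]` is non-decreasing, left-continuous, `φ(0) = 0` and
`h = h' ∘ φ`. Values of `φ` outside `[0, ζ(h)]` are irrelevant. -/
structure IsTimeChange (h h' : HeightFunction) (φ : ℝ → ℝ) : Prop where
  mapsTo : MapsTo φ (Icc 0 h.lifetime) (Icc 0 h'.lifetime)
  mono : MonotoneOn φ (Icc 0 h.lifetime)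
  left_cont : ∀ t ∈ Ioc 0 h.lifetime, Tendsto φ (𝓝[<] t) (𝓝 (φ t))
  zero : φ 0 = 0
  comp : ∀ t ∈ Icc 0 h.lifetime, h.toFun t = h'.toFun (φ t)

end HeightFunction

end

/-! By minimality almost every time lies in a first visit `[ℓ(σ), r(σ)]`. These intervals are
disjoint, ordered like the points of the tree, and of length `μ {σ}`. Composing the two coding
isometries gives an isometry `g` from `T_h` onto `T_h'` that respects roots and orders, and the
natural time change sends `ℓ(σ)` to `ℓ'(g σ)`, completed by left limits (`minLift`). It satisfies
`p' ∘ φ = g ∘ p`, that is, it is a lift of `g`; since a height is a distance to the root, this gives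
`h = h' ∘ φ`.

The converse, that every time change is a lift, is a rigidity statement. The equation `h = h' ∘ φ`
only makes `φ` expand tree distances (`IsTimeChange.dist_le`), so it induces an expanding self-map
of `T_h` that respects heights and order; on a compact tree such a map is the identity
(`eq_self_of_expanding`).

A lift carries the first visit of `σ` into that of `g σ` (`IsLift.mem_visit`) and `ℓ(σ)` to `ℓ'(g
σ)` (`IsLift.firstTime_eq`). The only freedom is how one interval is mapped into the other, so
uniqueness fails exactly when both are nondegenerate for some `σ`, a common atom. A jump of a lift
contains no first visit time in its interior, so it lies inside a single visit; this yields
constancy of `h'` there, and continuity when `μ'` has no atom. -/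

namespace HeightFunction

/-! ### Projections, heights and first visits. -/

section Basic

variable (h : HeightFunction)

theorem infBetween_le_of_le {s t v : ℝ} (hs : s ∈ Icc 0 h.lifetime) (ht : t ∈ Icc 0 h.lifetime)
    (hv : v ∈ Icc s t) : h.infBetween s t ≤ h.toFun v :=
  h.infBetween_le hs ht (Icc_subset_uIcc hv)

theorem proj_eq_proj_iff {s t : ℝ} (hs : s ∈ Icc 0 h.lifetime) (ht : t ∈ Icc 0 h.lifetime)
    (hst : s ≤ t) : h.proj s = h.proj t ↔
      h.toFun s = h.toFun t ∧ ∀ v ∈ Icc s t, h.toFun s ≤ h.toFun v := by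
  rw [← dist_eq_zero, h.dist_proj hs ht, timeDist]
  have h1 := h.infBetween_le_of_le hs ht (left_mem_Icc.2 hst)
  have h2 := h.infBetween_le_of_le hs ht (right_mem_Icc.2 hst)
  constructor
  · intro h0
    refine ⟨by linarith, fun v hv => ?_⟩
    have h3 := h.infBetween_le_of_le hs ht hv
    linarith
  · rintro ⟨h3, h4⟩
    have h5 : h.toFun s ≤ h.infBetween s t :=
      h.le_infBetween fun v hv => h4 v (by rwa [uIcc_of_le hst] at hv)
    linarith

/-- A dip of `h` between two times keeps the two points apart by at least the depth of the dip. This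
is the obstruction to recurrence in `eq_self_of_expanding`. -/
theorem sub_le_dist_proj_left {s t v : ℝ} (hs : s ∈ Icc 0 h.lifetime) (ht : t ∈ Icc 0 h.lifetime)
    (hv : v ∈ Icc s t) : h.toFun s - h.toFun v ≤ dist (h.proj s) (h.proj t) := by
  have h1 := h.infBetween_le_of_le hs ht hv
  have h2 := h.infBetween_le_of_le hs ht (right_mem_Icc.2 (hv.1.trans hv.2))
  rw [h.dist_proj hs ht, timeDist]
  linarith

theorem sub_le_dist_proj_right {s t v : ℝ} (hs : s ∈ Icc 0 h.lifetime)
    (ht : t ∈ Icc 0 h.lifetime) (hv : v ∈ Icc s t) :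
    h.toFun t - h.toFun v ≤ dist (h.proj s) (h.proj t) := by
  have h1 := h.infBetween_le_of_le hs ht hv
  have h2 := h.infBetween_le_of_le hs ht (left_mem_Icc.2 (hv.1.trans hv.2))
  rw [h.dist_proj hs ht, timeDist]
  linarith

theorem zero_mem : (0 : ℝ) ∈ Icc 0 h.lifetime := ⟨le_rfl, h.lifetime_nonneg⟩

theorem dist_root_proj {t : ℝ} (ht : t ∈ Icc 0 h.lifetime) :
    dist h.root (h.proj t) = h.toFun t := by
  have h1 : h.infBetween 0 t = 0 := by
    refine le_antisymm ?_ (h.le_infBetween fun r hr => h.nonneg r (uIcc_subset_Icc h.zero_mem ht hr))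
    simpa [h.zero] using h.infBetween_le_of_le h.zero_mem ht (left_mem_Icc.2 ht.1)
  rw [root, h.dist_proj h.zero_mem ht, timeDist, h1, h.zero]
  ring

theorem exists_proj_eq (σ : h.Tree) : ∃ t ∈ Icc 0 h.lifetime, h.proj t = σ := by
  obtain ⟨t, rfl⟩ := SeparationQuotient.surjective_mk σ
  refine ⟨t.1, t.2, ?_⟩
  unfold proj
  rw [projIcc_of_mem _ t.2]
  rfl

/-- A level below `h s` is attained by `h` at the last time before `s` at which `h` is at most
this level. -/
theorem exists_last_visit {s c : ℝ} (hs : s ∈ Icc 0 h.lifetime) (hc : 0 ≤ c)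
    (hcs : c ≤ h.toFun s) :
    ∃ u ∈ Icc 0 s, h.toFun u = c ∧ ∀ v ∈ Icc u s, c ≤ h.toFun v := by
  set A : Set ℝ := {v | v ∈ Icc 0 s ∧ h.toFun v ≤ c} with hA
  have h0A : (0 : ℝ) ∈ A := ⟨⟨le_rfl, hs.1⟩, by rw [h.zero]; exact hc⟩
  have hbdd : BddAbove A := ⟨s, fun v hv => hv.1.2⟩
  set u := sSup A with hu
  have hu0 : 0 ≤ u := le_csSup hbdd h0A
  have hus : u ≤ s := csSup_le ⟨0, h0A⟩ fun v hv => hv.1.2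
  have huI : u ∈ Icc 0 h.lifetime := ⟨hu0, hus.trans hs.2⟩
  have hgt : ∀ v ∈ Ioc u s, c < h.toFun v := by
    intro v hv
    by_contra! hle
    exact absurd (le_csSup hbdd (show v ∈ A from ⟨⟨hu0.trans hv.1.le, hv.2⟩, hle⟩))
      (not_le.2 hv.1)
  have huc : h.toFun u ≤ c := by
    by_cases huA : u ∈ A
    · exact huA.2
    have hpos : 0 < u := lt_of_le_of_ne hu0 fun h0 => huA (h0 ▸ h0A)
    by_contra! hlt
    have hev := (h.left_cont u ⟨hpos, huI.2⟩).eventually (lt_mem_nhds hlt)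
    obtain ⟨a, ha, hab⟩ := mem_nhdsLT_iff_exists_Ioo_subset.1 hev
    obtain ⟨v, hvA, hav⟩ := exists_lt_of_lt_csSup ⟨0, h0A⟩ (show a < sSup A from ha)
    have hvu : v < u := lt_of_le_of_ne (le_csSup hbdd hvA) fun he => huA (he ▸ hvA)
    exact absurd hvA.2 (not_le.2 (hab ⟨hav, hvu⟩))
  -- Just after `u` the values exceed `c`, hence so does weakly `h(u+)`, and `h(u+) ≤ h(u)`.
  have hcu : c ≤ h.toFun u := by
    rcases hus.eq_or_lt with he | hlt
    · rwa [he]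
    · obtain ⟨l, hl, hle⟩ := h.right_lim u ⟨hu0, hlt.trans_le hs.2⟩
      refine le_trans (ge_of_tendsto hl ?_) hle
      filter_upwards [Ioo_mem_nhdsGT hlt] with v hv
      exact (hgt v ⟨hv.1, hv.2.le⟩).le
  refine ⟨u, ⟨hu0, hus⟩, le_antisymm huc hcu, fun v hv => ?_⟩
  rcases hv.1.eq_or_lt with he | hlt
  · rwa [← he]
  · exact (hgt v ⟨hlt, hv.2⟩).le

theorem firstTime_le {σ : h.Tree} {t : ℝ} (ht : t ∈ Icc 0 h.lifetime) (hσ : h.proj t = σ) :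
    h.firstTime σ ≤ t :=
  csInf_le ⟨0, fun _ hv => hv.1.1⟩ ⟨ht, hσ⟩

theorem firstTime_mem (σ : h.Tree) : h.firstTime σ ∈ Icc 0 h.lifetime := by
  obtain ⟨t, ht, hσ⟩ := h.exists_proj_eq σ
  exact ⟨le_csInf ⟨t, ht, hσ⟩ fun v hv => hv.1.1, (h.firstTime_le ht hσ).trans ht.2⟩

/-- The infimum defining the first visit time is attained. -/
theorem proj_firstTime (σ : h.Tree) : h.proj (h.firstTime σ) = σ := by
  obtain ⟨t, ht, hσ⟩ := h.exists_proj_eq σ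
  have hle := h.firstTime_le ht hσ
  have hI := h.firstTime_mem σ
  rcases hle.eq_or_lt with he | hlt
  · rw [he, hσ]
  have hge : ∀ v ∈ Ioc (h.firstTime σ) t, h.toFun t ≤ h.toFun v := by
    intro v hv
    obtain ⟨s, hsA, hsv⟩ := exists_lt_of_csInf_lt
      (s := {t | t ∈ Icc 0 h.lifetime ∧ h.proj t = σ}) ⟨t, ht, hσ⟩ hv.1
    have := (h.proj_eq_proj_iff hsA.1 ht (hsv.le.trans hv.2)).1 (hsA.2.trans hσ.symm)
    exact this.1 ▸ this.2 v ⟨hsv.le, hv.2⟩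
  obtain ⟨l, hl, hle'⟩ := h.right_lim _ ⟨hI.1, hlt.trans_le ht.2⟩
  have hc : h.toFun t ≤ h.toFun (h.firstTime σ) := by
    refine le_trans (ge_of_tendsto hl ?_) hle'
    filter_upwards [Ioo_mem_nhdsGT hlt] with v hv
    exact hge v ⟨hv.1, hv.2.le⟩
  -- A downward jump at the infimum is not yet excluded. The last time `u` before it at the level of
  -- `σ` is again a visit to `σ`, so `u` is the infimum itself.
  obtain ⟨u, hu, huc, hu'⟩ := h.exists_last_visit hI (h.nonneg t ht) hc
  have huI : u ∈ Icc 0 h.lifetime := ⟨hu.1, hu.2.trans hI.2⟩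
  have hut : h.proj u = σ := by
    rw [← hσ, h.proj_eq_proj_iff huI ht (hu.2.trans hle)]
    refine ⟨huc, fun v hv => huc ▸ ?_⟩
    rcases le_or_gt v (h.firstTime σ) with h1 | h1
    · exact hu' v ⟨hv.1, h1⟩
    · exact hge v ⟨h1, hv.2⟩
  rw [le_antisymm (h.firstTime_le huI hut) hu.2, hut]

theorem firstTime_injective : Function.Injective h.firstTime := fun σ τ hστ => by
  rw [← h.proj_firstTime σ, hστ, h.proj_firstTime]

theorem firstTime_root : h.firstTime h.root = 0 :=
  le_antisymm (h.firstTime_le h.zero_mem rfl) (h.firstTime_mem _).1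

/-- A point is first visited before its descendants. -/
theorem firstTime_le_of_forall_le {s t : ℝ} (hs : s ∈ Icc 0 h.lifetime)
    (ht : t ∈ Icc 0 h.lifetime) (hst : s ≤ t) (hle : ∀ v ∈ Icc s t, h.toFun t ≤ h.toFun v) :
    h.firstTime (h.proj t) ≤ s := by
  obtain ⟨u, hu, huc, hu'⟩ :=
    h.exists_last_visit hs (h.nonneg t ht) (hle s (left_mem_Icc.2 hst))
  have huI : u ∈ Icc 0 h.lifetime := ⟨hu.1, hu.2.trans hs.2⟩
  refine (h.firstTime_le huI ?_).trans hu.2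
  rw [h.proj_eq_proj_iff huI ht (hu.2.trans hst)]
  refine ⟨huc, fun v hv => huc ▸ ?_⟩
  rcases le_or_gt v s with h1 | h1
  · exact hu' v ⟨hv.1, h1⟩
  · exact hle v ⟨h1.le, hv.2⟩

theorem exitTime_le_lifetime (σ : h.Tree) : h.exitTime σ ≤ h.lifetime := by
  refine csInf_le ⟨0, ?_⟩ (mem_insert _ _)
  rintro v (rfl | hv)
  · exact h.lifetime_nonneg
  · exact hv.1.1

theorem firstTime_le_exitTime (σ : h.Tree) : h.firstTime σ ≤ h.exitTime σ := by
  refine le_csInf (insert_nonempty _ _) ?_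
  rintro v (rfl | hv)
  · exact (h.firstTime_mem σ).2
  · exact hv.2.1.le

theorem exitTime_mem (σ : h.Tree) : h.exitTime σ ∈ Icc 0 h.lifetime :=
  ⟨(h.firstTime_mem σ).1.trans (h.firstTime_le_exitTime σ), h.exitTime_le_lifetime σ⟩

theorem mem_of_mem_visit {σ : h.Tree} {t : ℝ} (ht : t ∈ Icc (h.firstTime σ) (h.exitTime σ)) :
    t ∈ Icc 0 h.lifetime :=
  ⟨(h.firstTime_mem σ).1.trans ht.1, ht.2.trans (h.exitTime_le_lifetime σ)⟩

/-- Before the exit time this is the definition of the infimum; the exit time itself is included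
because `p_h` is left-continuous. -/
theorem proj_eq_of_mem_visit {σ : h.Tree} {t : ℝ}
    (ht : t ∈ Icc (h.firstTime σ) (h.exitTime σ)) : h.proj t = σ := by
  have key : ∀ v, h.firstTime σ ≤ v → v < h.exitTime σ → h.proj v = σ := by
    intro v h1 h2
    rcases h1.eq_or_lt with rfl | h1
    · exact h.proj_firstTime σ
    by_contra hne
    have hv : v ∈ {t | t ∈ Icc 0 h.lifetime ∧ h.firstTime σ < t ∧ h.proj t ≠ σ} :=
      ⟨h.mem_of_mem_visit ⟨h1.le, h2.le⟩, h1, hne⟩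
    refine absurd (show h.exitTime σ ≤ v from csInf_le ⟨0, ?_⟩ (mem_insert_of_mem _ hv))
      (not_le.2 h2)
    rintro v (rfl | hv)
    · exact h.lifetime_nonneg
    · exact hv.1.1
  rcases ht.1.eq_or_lt with rfl | h1
  · exact h.proj_firstTime σ
  refine tendsto_nhds_unique ((h.proj_tendsto_left t).congr' ?_) tendsto_const_nhds
  filter_upwards [Ioo_mem_nhdsLT h1] with v hv
  exact key v hv.1.le (hv.2.trans_le ht.2)

/-- Otherwise `ℓ(τ)` would lie in the visit of `σ`, where the projection is `σ`. Thus visits are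
disjoint closed intervals in the order of their points. -/
theorem exitTime_lt_firstTime {σ τ : h.Tree} (hστ : h.firstTime σ < h.firstTime τ) :
    h.exitTime σ < h.firstTime τ := by
  by_contra! hle
  have := h.proj_eq_of_mem_visit ⟨hστ.le, hle⟩
  rw [h.proj_firstTime] at this
  exact hστ.ne (by rw [this])

/-! ### Consequences of minimality. -/

variable {h}

/-- The first visits to points of the tree are dense in time. -/
theorem IsMinimal.exists_visit (hmin : h.IsMinimal) {a b : ℝ} (ha : 0 ≤ a) (hab : a < b)
    (hb : b ≤ h.lifetime) :
    ∃ t ∈ Ioo a b, ∃ σ, t ∈ Icc (h.firstTime σ) (h.exitTime σ) := by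
  by_contra! hcon
  have hsub : Ioo a b ⊆ h.latterVisits := fun t ht =>
    ⟨⟨ha.trans ht.1.le, ht.2.le.trans hb⟩, fun hF => by
      obtain ⟨σ, hσ⟩ := mem_iUnion.1 hF
      exact hcon t ht σ hσ⟩
  have h1 := measure_mono_null hsub hmin
  rw [Real.volume_Ioo, ENNReal.ofReal_eq_zero] at h1
  linarith

/-- A time at `σ` outside the first visit of `σ` belongs to no visit at all, and such times are
null. Conditions on atoms thereby become conditions on lengths of visits. -/
theorem IsMinimal.treeMeasure_singleton (hmin : h.IsMinimal) (σ : h.Tree) :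
    h.treeMeasure {σ} = ENNReal.ofReal (h.exitTime σ - h.firstTime σ) := by
  rw [h.treeMeasure_apply (measurableSet_singleton σ), ← Real.volume_Icc]
  refine le_antisymm ?_ (measure_mono fun t ht =>
    ⟨h.mem_of_mem_visit ht, h.proj_eq_of_mem_visit ht⟩)
  have hsub : {t | t ∈ Icc 0 h.lifetime ∧ h.proj t ∈ ({σ} : Set h.Tree)} ⊆
      Icc (h.firstTime σ) (h.exitTime σ) ∪ h.latterVisits := by
    rintro t ⟨ht, hσ⟩
    by_cases hF : t ∈ h.firstVisits
    · obtain ⟨τ, hτ⟩ := mem_iUnion.1 hF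
      have := h.proj_eq_of_mem_visit hτ
      rw [mem_singleton_iff.1 hσ] at this
      exact Or.inl (this ▸ hτ)
    · exact Or.inr ⟨ht, hF⟩
  refine (measure_mono hsub).trans ((measure_union_le _ _).trans ?_)
  rw [show volume h.latterVisits = 0 from hmin, add_zero]

theorem treeMeasure_univ : h.treeMeasure univ = ENNReal.ofReal h.lifetime := by
  rw [h.treeMeasure_apply MeasurableSet.univ]
  have : {t | t ∈ Icc 0 h.lifetime ∧ h.proj t ∈ (univ : Set h.Tree)} = Icc 0 h.lifetime := by
    ext t
    simp
  rw [this, Real.volume_Icc, sub_zero]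

end Basic

end HeightFunction

/-! ### Rigidity of compact coded trees. -/

/-- An expanding self-map of a compact metric space brings every point back close to itself. -/
theorem exists_iterate_dist_lt_of_expanding {X : Type*} [MetricSpace X] [CompactSpace X]
    {S : X → X} (hS : ∀ x y, dist x y ≤ dist (S x) (S y)) (x : X) {ε : ℝ} (hε : 0 < ε) :
    ∃ k, dist x (S^[k + 1] x) < ε := by
  have hiter : ∀ n x y, dist x y ≤ dist (S^[n] x) (S^[n] y) := by
    intro n
    induction n with
    | zero => exact fun x y => le_rfl
    | succ n ih =>
      intro x y
      rw [Function.iterate_succ_apply, Function.iterate_succ_apply]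
      exact (hS x y).trans (ih _ _)
  obtain ⟨a, u, hu, hlim⟩ := CompactSpace.tendsto_subseq fun n => S^[n] x
  obtain ⟨N, hN⟩ := Metric.cauchySeq_iff'.1 hlim.cauchySeq ε hε
  obtain ⟨k, hk⟩ := Nat.exists_eq_add_of_lt (hu (Nat.lt_succ_self N))
  -- Two iterates along the subsequence are close; removing their `u N` common applications of `S`
  -- can only bring them closer.
  refine ⟨k, (hiter (u N) _ _).trans_lt ?_⟩
  rw [← Function.iterate_add_apply, dist_comm, ← add_assoc, ← hk]
  exact hN (N + 1) (Nat.le_succ N)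

namespace HeightFunction

/-- Isometries between coded trees that preserve the root and the order. -/
structure IsTreeIso {h h' : HeightFunction} (g : h.Tree ≃ᵢ h'.Tree) : Prop where
  map_root : g h.root = h'.root
  lt : ∀ σ τ, h.firstTime σ < h.firstTime τ → h'.firstTime (g σ) < h'.firstTime (g τ)

/-- An expanding, height preserving and order preserving self-map of a compact coded tree is the
identity. -/
theorem eq_self_of_expanding {h : HeightFunction} [CompactSpace h.Tree] {S : h.Tree → h.Tree}
    (hS : ∀ σ τ, dist σ τ ≤ dist (S σ) (S τ))
    (hheight : ∀ σ, h.toFun (h.firstTime (S σ)) = h.toFun (h.firstTime σ))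
    (hmono : ∀ σ τ, h.firstTime σ ≤ h.firstTime τ → h.firstTime (S σ) ≤ h.firstTime (S τ))
    (σ : h.Tree) : S σ = σ := by
  have hI := h.firstTime_mem
  rcases lt_trichotomy (h.firstTime (S σ)) (h.firstTime σ) with hlt | heq | hlt
  · exfalso
    have hk : ∀ k, h.firstTime (S^[k + 1] σ) ≤ h.firstTime (S σ) := by
      intro k
      induction k with
      | zero => exact le_rfl
      | succ k ih =>
        rw [Function.iterate_succ_apply']
        exact hmono _ _ (ih.trans hlt.le)
    -- Without such a dip, `σ` would already be visited by the time `ℓ(S σ)`. All iterates are first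
    -- visited before the dip, so none returns near `σ`.
    have hex : ∃ v ∈ Icc (h.firstTime (S σ)) (h.firstTime σ),
        h.toFun v < h.toFun (h.firstTime σ) := by
      by_contra! hcon
      have := h.firstTime_le_of_forall_le (hI _) (hI _) hlt.le hcon
      rw [h.proj_firstTime] at this
      exact this.not_gt hlt
    obtain ⟨v, hv, hvlt⟩ := hex
    obtain ⟨k, hdist⟩ := exists_iterate_dist_lt_of_expanding hS σ (sub_pos.2 hvlt)
    have := h.sub_le_dist_proj_right (hI _) (hI σ) (⟨(hk k).trans hv.1, hv.2⟩ :
      v ∈ Icc (h.firstTime (S^[k + 1] σ)) (h.firstTime σ))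
    rw [h.proj_firstTime, h.proj_firstTime, dist_comm] at this
    exact this.not_gt hdist
  · exact h.firstTime_injective heq
  · exfalso
    have hk : ∀ k, h.firstTime (S σ) ≤ h.firstTime (S^[k + 1] σ) := by
      intro k
      induction k with
      | zero => exact le_rfl
      | succ k ih =>
        rw [Function.iterate_succ_apply']
        exact hmono _ _ (hlt.le.trans ih)
    -- Without a dip `S σ` would descend from `σ`, and equal heights would force `S σ = σ`.
    have hex : ∃ v ∈ Icc (h.firstTime σ) (h.firstTime (S σ)),
        h.toFun v < h.toFun (h.firstTime σ) := by
      by_contra! hcon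
      have := (h.proj_eq_proj_iff (hI _) (hI _) hlt.le).2 ⟨(hheight σ).symm, hcon⟩
      rw [h.proj_firstTime, h.proj_firstTime] at this
      rw [← this] at hlt
      exact hlt.ne rfl
    obtain ⟨v, hv, hvlt⟩ := hex
    obtain ⟨k, hdist⟩ := exists_iterate_dist_lt_of_expanding hS σ (sub_pos.2 hvlt)
    have := h.sub_le_dist_proj_left (hI σ) (hI _) (⟨hv.1, hv.2.trans (hk k)⟩ :
      v ∈ Icc (h.firstTime σ) (h.firstTime (S^[k + 1] σ)))
    rw [h.proj_firstTime, h.proj_firstTime] at this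
    exact this.not_gt hdist

/-! ### Time changes are compatible with the projections. -/

variable {h h' : HeightFunction} {g : h.Tree ≃ᵢ h'.Tree} {φ : ℝ → ℝ}

theorem IsTreeIso.le (hg : IsTreeIso g) {σ τ : h.Tree} (hστ : h.firstTime σ ≤ h.firstTime τ) :
    h'.firstTime (g σ) ≤ h'.firstTime (g τ) := by
  rcases hστ.eq_or_lt with he | hlt
  · rw [h.firstTime_injective he]
  · exact (hg.lt _ _ hlt).le

theorem IsTreeIso.le_iff (hg : IsTreeIso g) {σ τ : h.Tree} :
    h'.firstTime (g σ) ≤ h'.firstTime (g τ) ↔ h.firstTime σ ≤ h.firstTime τ :=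
  ⟨fun hle => not_lt.1 fun hlt => (hg.lt _ _ hlt).not_ge hle, hg.le⟩

theorem IsTreeIso.lt_iff (hg : IsTreeIso g) {σ τ : h.Tree} :
    h'.firstTime (g σ) < h'.firstTime (g τ) ↔ h.firstTime σ < h.firstTime τ :=
  lt_iff_lt_of_le_iff_le hg.le_iff

theorem IsTreeIso.toFun_eq (hg : IsTreeIso g) {s t : ℝ} (hs : s ∈ Icc 0 h.lifetime)
    (ht : t ∈ Icc 0 h'.lifetime) (hst : h'.proj t = g (h.proj s)) :
    h'.toFun t = h.toFun s := by
  rw [← h'.dist_root_proj ht, ← h.dist_root_proj hs, hst, ← hg.map_root, g.dist_eq]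

/-- The image of the times between `s` and `t` may skip values between `φ s` and `φ t`, so the
infimum of `h'` there can only be smaller. -/
theorem IsTimeChange.dist_le (hφ : h.IsTimeChange h' φ) {s t : ℝ} (hs : s ∈ Icc 0 h.lifetime)
    (ht : t ∈ Icc 0 h.lifetime) :
    dist (h.proj s) (h.proj t) ≤ dist (h'.proj (φ s)) (h'.proj (φ t)) := by
  rw [h.dist_proj hs ht, h'.dist_proj (hφ.mapsTo hs) (hφ.mapsTo ht), timeDist, timeDist,
    ← hφ.comp s hs, ← hφ.comp t ht]
  have : h'.infBetween (φ s) (φ t) ≤ h.infBetween s t := by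
    refine h.le_infBetween fun r hr => ?_
    have hrI := uIcc_subset_Icc hs ht hr
    rw [hφ.comp r hrI]
    refine h'.infBetween_le (hφ.mapsTo hs) (hφ.mapsTo ht) ?_
    rcases le_total s t with hst | hst
    · rw [uIcc_of_le hst] at hr
      exact Icc_subset_uIcc ⟨hφ.mono hs hrI hr.1, hφ.mono hrI ht hr.2⟩
    · rw [uIcc_of_ge hst] at hr
      exact Icc_subset_uIcc' ⟨hφ.mono ht hrI hr.1, hφ.mono hrI hs hr.2⟩
  linarith

/-- A time change between two codings of the same compact tree is compatible with the
projections. -/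
theorem IsTimeChange.proj_eq [CompactSpace h.Tree] (hφ : h.IsTimeChange h' φ) (hg : IsTreeIso g)
    {t : ℝ} (ht : t ∈ Icc 0 h.lifetime) : h'.proj (φ t) = g (h.proj t) := by
  have hI := h.firstTime_mem
  have hI' := fun σ => hφ.mapsTo (hI σ)
  set S : h.Tree → h.Tree := fun σ => g.symm (h'.proj (φ (h.firstTime σ))) with hSdef
  have hgS : ∀ σ, g (S σ) = h'.proj (φ (h.firstTime σ)) := fun σ => g.apply_symm_apply _
  have hS : ∀ σ τ, dist σ τ ≤ dist (S σ) (S τ) := by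
    intro σ τ
    rw [← g.dist_eq (S σ), hgS, hgS]
    simpa only [h.proj_firstTime] using hφ.dist_le (hI σ) (hI τ)
  have hheight : ∀ σ, h.toFun (h.firstTime (S σ)) = h.toFun (h.firstTime σ) := by
    intro σ
    rw [hφ.comp _ (hI σ)]
    refine (hg.toFun_eq (hI _) (hI' σ) ?_).symm
    rw [h.proj_firstTime, hgS]
  have hmono : ∀ σ τ, h.firstTime σ ≤ h.firstTime τ →
      h.firstTime (S σ) ≤ h.firstTime (S τ) := by
    intro σ τ hστ
    rw [← hg.le_iff]
    -- If the order were reversed, `g (S τ)` would be visited before `φ (ℓ σ)` and again at `φ (ℓ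
    -- τ)`. Then `h'`, hence `h` between `ℓ(σ)` and `ℓ(τ)`, stays above the height of `τ`, which
    -- forces `ℓ(τ) ≤ ℓ(σ)`.
    by_contra! hlt
    rw [hgS, hgS] at hlt
    have h1 : h'.firstTime (h'.proj (φ (h.firstTime σ))) ≤ φ (h.firstTime σ) :=
      h'.firstTime_le (hI' σ) rfl
    have h2 := hφ.mono (hI σ) (hI τ) hστ
    have h3 := (h'.proj_eq_proj_iff (h'.firstTime_mem _) (hI' τ)
      (hlt.le.trans (h1.trans h2))).1 (h'.proj_firstTime _)
    have h4 : ∀ v ∈ Icc (h.firstTime σ) (h.firstTime τ),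
        h.toFun (h.firstTime τ) ≤ h.toFun v := by
      intro v hv
      have hvI : v ∈ Icc 0 h.lifetime := ⟨(hI σ).1.trans hv.1, hv.2.trans (hI τ).2⟩
      rw [hφ.comp _ (hI τ), hφ.comp v hvI, ← h3.1]
      exact h3.2 _ ⟨hlt.le.trans (h1.trans (hφ.mono (hI σ) hvI hv.1)), hφ.mono hvI (hI τ) hv.2⟩
    have h5 := h.firstTime_le_of_forall_le (hI σ) (hI τ) hστ h4
    rw [h.proj_firstTime] at h5
    have : σ = τ := h.firstTime_injective (le_antisymm hστ h5)
    rw [this] at hlt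
    exact hlt.ne rfl
  have hid := eq_self_of_expanding hS hheight hmono
  set τ := g.symm (h'.proj (φ t)) with hτ
  have hgτ : g τ = h'.proj (φ t) := g.apply_symm_apply _
  -- Rigidity only concerns first visit times. Expansion between `t` and `ℓ(τ)`, whose images
  -- project to the same point `g τ`, extends it to all `t`.
  have h1 := hφ.dist_le ht (hI τ)
  rw [h.proj_firstTime, ← hgS τ, hid τ, ← hgτ, dist_self] at h1
  rw [← hgτ, dist_le_zero.1 h1]

/-! ### Lifts: values on visits, uniqueness and jumps. -/

/-- Compatibility of a time change with the projections. -/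
structure IsLift (g : h.Tree ≃ᵢ h'.Tree) (φ : ℝ → ℝ) : Prop where
  mapsTo : MapsTo φ (Icc 0 h.lifetime) (Icc 0 h'.lifetime)
  mono : MonotoneOn φ (Icc 0 h.lifetime)
  left_cont : ∀ t ∈ Ioc 0 h.lifetime, Tendsto φ (𝓝[<] t) (𝓝 (φ t))
  zero : φ 0 = 0
  proj_eq : ∀ t ∈ Icc 0 h.lifetime, h'.proj (φ t) = g (h.proj t)

theorem IsTimeChange.isLift [CompactSpace h.Tree] (hφ : h.IsTimeChange h' φ)
    (hg : IsTreeIso g) : IsLift g φ :=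
  ⟨hφ.mapsTo, hφ.mono, hφ.left_cont, hφ.zero, fun _ ht => hφ.proj_eq hg ht⟩

theorem IsLift.isTimeChange (hφ : IsLift g φ) (hg : IsTreeIso g) : h.IsTimeChange h' φ :=
  ⟨hφ.mapsTo, hφ.mono, hφ.left_cont, hφ.zero, fun t ht =>
    (hg.toFun_eq ht (hφ.mapsTo ht) (hφ.proj_eq t ht)).symm⟩

namespace IsLift

/-- A lift maps the first visit to a point into the first visit to its image. -/
theorem mem_visit (hφ : IsLift g φ) (hg : IsTreeIso g) (hmin' : h'.IsMinimal) {σ : h.Tree} {t : ℝ}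
    (ht : t ∈ Icc (h.firstTime σ) (h.exitTime σ)) :
    φ t ∈ Icc (h'.firstTime (g σ)) (h'.exitTime (g σ)) := by
  have htI := h.mem_of_mem_visit ht
  have hpt : h'.proj (φ t) = g σ := by rw [hφ.proj_eq t htI, h.proj_eq_of_mem_visit ht]
  refine ⟨h'.firstTime_le (hφ.mapsTo htI) hpt, ?_⟩
  by_contra! hlt
  obtain ⟨u, hu, τ', hτ'⟩ := hmin'.exists_visit (h'.exitTime_mem (g σ)).1 hlt (hφ.mapsTo htI).2
  obtain ⟨τ, rfl⟩ := g.surjective τ'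
  have h1 : h'.firstTime (g σ) < h'.firstTime (g τ) := by
    by_contra! hle
    rcases hle.eq_or_lt with he | hlt
    · rw [h'.firstTime_injective he] at hτ'
      exact hu.1.not_ge hτ'.2
    · linarith [h'.exitTime_lt_firstTime hlt, hu.1, hτ'.2, h'.firstTime_le_exitTime (g σ)]
  have h2 := h.exitTime_lt_firstTime (hg.lt_iff.1 h1)
  have hτI := h.firstTime_mem τ
  have h3 : h'.proj (φ (h.firstTime τ)) = g τ := by rw [hφ.proj_eq _ hτI, h.proj_firstTime]
  have h4 : φ t ≤ φ (h.firstTime τ) := hφ.mono htI hτI (ht.2.trans h2.le)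
  have hlast : h'.firstTime (g τ) ≤ φ t := hτ'.1.trans hu.2.le
  -- The times `ℓ'(g σ) < ℓ'(g τ) ≤ φ t ≤ φ (ℓ τ)` visit `g σ` and `g τ` alternately. Each point
  -- then has height at most that of the other, with no dip in between, so they coincide.
  have hA := (h'.proj_eq_proj_iff (h'.firstTime_mem _) (hφ.mapsTo htI) (h1.le.trans hlast)).1
    ((h'.proj_firstTime _).trans hpt.symm)
  have hB := (h'.proj_eq_proj_iff (h'.firstTime_mem _) (hφ.mapsTo hτI) (hlast.trans h4)).1
    ((h'.proj_firstTime _).trans h3.symm)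
  have hC : h'.proj (h'.firstTime (g σ)) = h'.proj (h'.firstTime (g τ)) := by
    refine (h'.proj_eq_proj_iff (h'.firstTime_mem _) (h'.firstTime_mem _) h1.le).2 ⟨?_, ?_⟩
    · exact le_antisymm (hA.2 _ ⟨h1.le, hlast⟩) (hA.1 ▸ hB.2 _ ⟨hlast, h4⟩)
    · exact fun v hv => hA.2 v ⟨hv.1, hv.2.trans hlast⟩
  rw [h'.proj_firstTime, h'.proj_firstTime] at hC
  rw [hC] at h1
  exact h1.ne rfl

/-- A lift preserves first visit times. -/
theorem firstTime_eq (hφ : IsLift g φ) (hg : IsTreeIso g) (hmin : h.IsMinimal)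
    (hmin' : h'.IsMinimal) (σ : h.Tree) : φ (h.firstTime σ) = h'.firstTime (g σ) := by
  have hI := h.firstTime_mem σ
  refine le_antisymm ?_
    (hφ.mem_visit hg hmin' (left_mem_Icc.2 (h.firstTime_le_exitTime σ))).1
  rcases hI.1.eq_or_lt with h0 | h0
  · rw [← h0, hφ.zero]
    exact (h'.firstTime_mem _).1
  -- Arbitrarily close before `ℓ(σ)` there are visits to earlier points, whose images end before
  -- `ℓ'(g σ)`; left-continuity concludes.
  refine le_of_tendsto_of_frequently (hφ.left_cont _ ⟨h0, hI.2⟩) ?_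
  rw [(nhdsLT_basis (h.firstTime σ)).frequently_iff]
  intro a ha
  obtain ⟨s, hs, τ, hτ⟩ := hmin.exists_visit (le_max_right a 0) (max_lt ha h0) hI.2
  refine ⟨s, ⟨(le_max_left _ _).trans_lt hs.1, hs.2⟩, ?_⟩
  exact (hφ.mem_visit hg hmin' hτ).2.trans
    (h'.exitTime_lt_firstTime (hg.lt _ _ (hτ.1.trans_lt hs.2))).le

/-- Two lifts agree if they agree during first visits. -/
theorem eqOn_of_forall_visit {ψ : ℝ → ℝ} (hφ : IsLift g φ) (hψ : IsLift g ψ) (hmin : h.IsMinimal)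
    (heq : ∀ σ, ∀ t ∈ Icc (h.firstTime σ) (h.exitTime σ), φ t = ψ t) :
    EqOn φ ψ (Icc 0 h.lifetime) := by
  intro t ht
  rcases ht.1.eq_or_lt with h0 | h0
  · rw [← h0, hφ.zero, hψ.zero]
  refine tendsto_nhds_unique_of_frequently_eq (hφ.left_cont t ⟨h0, ht.2⟩)
    (hψ.left_cont t ⟨h0, ht.2⟩) ?_
  rw [(nhdsLT_basis t).frequently_iff]
  intro a ha
  obtain ⟨s, hs, τ, hτ⟩ := hmin.exists_visit (le_max_right a 0) (max_lt ha h0) ht.2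
  exact ⟨s, ⟨(le_max_left _ _).trans_lt hs.1, hs.2⟩, heq τ s hτ⟩

/-- Either the visit of `σ` is the single instant `ℓ(σ)`, whose image is forced, or the visit of `g
σ` is a single instant and leaves no choice of value. -/
theorem eqOn_of_no_common_atom {ψ : ℝ → ℝ} (hφ : IsLift g φ) (hψ : IsLift g ψ)
    (hg : IsTreeIso g) (hmin : h.IsMinimal) (hmin' : h'.IsMinimal)
    (hatom : ∀ σ, h.exitTime σ ≤ h.firstTime σ ∨ h'.exitTime (g σ) ≤ h'.firstTime (g σ)) :
    EqOn φ ψ (Icc 0 h.lifetime) := by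
  refine hφ.eqOn_of_forall_visit hψ hmin fun σ t ht => ?_
  rcases hatom σ with h1 | h1
  · rw [le_antisymm (ht.2.trans h1) ht.1, hφ.firstTime_eq hg hmin hmin',
      hψ.firstTime_eq hg hmin hmin']
  · have hA := hφ.mem_visit hg hmin' ht
    have hB := hψ.mem_visit hg hmin' ht
    linarith [hA.1, hA.2, hB.1, hB.2]

theorem exists_rightLim (hφ : IsLift g φ) {t : ℝ} (ht : t ∈ Ico 0 h.lifetime) :
    ∃ b, Tendsto φ (𝓝[>] t) (𝓝 b) ∧ φ t ≤ b ∧ b ≤ h'.lifetime ∧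
      ∀ s ∈ Icc 0 h.lifetime, t < s → b ≤ φ s := by
  have htI : t ∈ Icc 0 h.lifetime := ⟨ht.1, ht.2.le⟩
  have hsub : Ioo t h.lifetime ⊆ Icc 0 h.lifetime := fun s hs => ⟨ht.1.trans hs.1.le, hs.2.le⟩
  have hbdd : BddBelow (φ '' Ioo t h.lifetime) :=
    ⟨0, by rintro _ ⟨s, hs, rfl⟩; exact (hφ.mapsTo (hsub hs)).1⟩
  have hne : (Ioo t h.lifetime).Nonempty := nonempty_Ioo.2 ht.2
  have hlim := (hφ.mono.mono hsub).tendsto_nhdsWithin_Ioo_right hne hbdd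
  have hle : ∀ s ∈ Icc 0 h.lifetime, t < s → sInf (φ '' Ioo t h.lifetime) ≤ φ s := by
    intro s hs hts
    have hm : (t + s) / 2 ∈ Ioo t h.lifetime := ⟨by linarith, by linarith [hs.2]⟩
    exact (csInf_le hbdd (mem_image_of_mem φ hm)).trans
      (hφ.mono (hsub hm) hs (by linarith))
  refine ⟨_, hlim, le_csInf (hne.image φ) ?_, ?_, hle⟩
  · rintro _ ⟨s, hs, rfl⟩
    exact hφ.mono htI (hsub hs) hs.1.le
  · have hM : h.lifetime ∈ Icc 0 h.lifetime := ⟨h.lifetime_nonneg, le_rfl⟩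
    exact (hle _ hM ht.2).trans (hφ.mapsTo hM).2

/-- No first visit time lies in a jump of a lift. -/
theorem firstTime_notMem_jump (hφ : IsLift g φ) (hg : IsTreeIso g) (hmin : h.IsMinimal)
    (hmin' : h'.IsMinimal) {t b : ℝ} (ht : t ∈ Icc 0 h.lifetime)
    (hb : ∀ s ∈ Icc 0 h.lifetime, t < s → b ≤ φ s) (τ : h'.Tree) :
    h'.firstTime τ ∉ Ioo (φ t) b := by
  obtain ⟨σ, rfl⟩ := g.surjective τ
  rw [← hφ.firstTime_eq hg hmin hmin']
  have hI := h.firstTime_mem σ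
  rintro ⟨h1, h2⟩
  rcases le_or_gt (h.firstTime σ) t with h3 | h3
  · exact (hφ.mono hI ht h3).not_gt h1
  · exact (hb _ hI h3).not_gt h2

/-- The function `h'` is constant on the jumps of a lift. -/
theorem toFun_eq_of_mem_jump (hφ : IsLift g φ) (hg : IsTreeIso g) (hmin : h.IsMinimal)
    (hmin' : h'.IsMinimal) {t b : ℝ} (ht : t ∈ Icc 0 h.lifetime) (hlt : φ t < b)
    (hbM : b ≤ h'.lifetime) (hb : ∀ s ∈ Icc 0 h.lifetime, t < s → b ≤ φ s) {u : ℝ}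
    (hu : u ∈ Icc (φ t) b) : h'.toFun u = h.toFun t := by
  have hjump := hφ.firstTime_notMem_jump hg hmin hmin' ht hb
  have h0 := (hφ.mapsTo ht).1
  have hfirst : ∀ v ∈ Ioo (φ t) b, ∀ τ, v ∈ Icc (h'.firstTime τ) (h'.exitTime τ) →
      h'.firstTime τ ≤ φ t := fun v hv τ hτ => by
    by_contra! hc
    exact hjump τ ⟨hc, hτ.1.trans_lt hv.2⟩
  obtain ⟨v, hv, τ, hτ⟩ := hmin'.exists_visit h0 hlt hbM
  -- If the visit of `τ` ended inside the jump, a later visit would meet the jump too. That one must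
  -- also have begun by `φ t`, so it would overlap the visit of `τ`.
  have hτb : b ≤ h'.exitTime τ := by
    by_contra! hlt'
    obtain ⟨w, hw, κ, hκ⟩ := hmin'.exists_visit (h'.exitTime_mem τ).1 hlt' hbM
    have hκ1 := hfirst w ⟨hv.1.trans (hτ.2.trans_lt hw.1), hw.2⟩ κ hκ
    have hκτ : h'.proj v = κ := h'.proj_eq_of_mem_visit
      ⟨hκ1.trans hv.1.le, (hτ.2.trans hw.1.le).trans hκ.2⟩
    rw [h'.proj_eq_of_mem_visit hτ] at hκτ
    rw [← hκτ] at hκ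
    exact hw.1.not_ge hκ.2
  have hp : ∀ w ∈ Icc (φ t) b, w ∈ Icc (h'.firstTime τ) (h'.exitTime τ) := fun w hw =>
    ⟨(hfirst v hv τ hτ).trans hw.1, hw.2.trans hτb⟩
  refine hg.toFun_eq ht (h'.mem_of_mem_visit (hp u hu)) ?_
  rw [h'.proj_eq_of_mem_visit (hp u hu), ← hφ.proj_eq t ht,
    h'.proj_eq_of_mem_visit (hp _ (left_mem_Icc.2 hlt.le))]

/-- A jump would contain a visit time of `h'`. Without atoms this is a first visit time, and none
lies in a jump. -/
theorem continuousOn (hφ : IsLift g φ) (hg : IsTreeIso g) (hmin : h.IsMinimal)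
    (hmin' : h'.IsMinimal) (hatom : ∀ τ, h'.exitTime τ ≤ h'.firstTime τ) :
    ContinuousOn φ (Icc 0 h.lifetime) := by
  intro t ht
  have hleft : ContinuousWithinAt φ (Icc 0 h.lifetime ∩ Iio t) t := by
    rcases ht.1.eq_or_lt with h0 | h0
    · rw [← h0, show Icc 0 h.lifetime ∩ Iio 0 = ∅ from
        eq_empty_of_forall_notMem fun s hs => hs.1.1.not_gt hs.2]
      exact continuousWithinAt_of_notMem_closure (by simp)
    · exact (hφ.left_cont t ⟨h0, ht.2⟩).mono_left (nhdsWithin_mono _ inter_subset_right)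
  have hright : ContinuousWithinAt φ (Icc 0 h.lifetime ∩ Ioi t) t := by
    rcases ht.2.eq_or_lt with h0 | h0
    · rw [h0, show Icc 0 h.lifetime ∩ Ioi h.lifetime = ∅ from
        eq_empty_of_forall_notMem fun s hs => hs.1.2.not_gt hs.2]
      exact continuousWithinAt_of_notMem_closure (by simp)
    · obtain ⟨b, hlim, hle, hbM, hb⟩ := hφ.exists_rightLim ⟨ht.1, h0⟩
      have : b = φ t := by
        refine le_antisymm ?_ hle
        by_contra! hlt
        obtain ⟨v, hv, τ, hτ⟩ := hmin'.exists_visit (hφ.mapsTo ht).1 hlt hbM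
        refine hφ.firstTime_notMem_jump hg hmin hmin' ht hb τ ?_
        rwa [le_antisymm hτ.1 (hτ.2.trans (hatom τ))]
      rw [this] at hlim
      exact hlim.mono_left (nhdsWithin_mono _ inter_subset_right)
  have hunion := (hleft.union hright).union
    (continuousWithinAt_singleton (f := φ) (x := t))
  refine hunion.mono fun s hs => ?_
  rcases lt_trichotomy s t with h1 | h1 | h1
  · exact Or.inl (Or.inl ⟨hs, h1⟩)
  · exact Or.inr h1
  · exact Or.inl (Or.inr ⟨hs, h1⟩)

/-- Between `s` and `t` there are two visit times. Without atoms they are first visit times of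
distinct points, and lifts keep these in strict order. -/
theorem strictMonoOn (hφ : IsLift g φ) (hg : IsTreeIso g) (hmin : h.IsMinimal)
    (hmin' : h'.IsMinimal) (hatom : ∀ σ, h.exitTime σ ≤ h.firstTime σ) :
    StrictMonoOn φ (Icc 0 h.lifetime) := by
  intro s hs t ht hst
  obtain ⟨u, hu, σ, hσ⟩ := hmin.exists_visit hs.1 hst ht.2
  have huI : u ∈ Icc 0 h.lifetime := h.mem_of_mem_visit hσ
  obtain ⟨v, hv, τ, hτ⟩ := hmin.exists_visit huI.1 hu.2 ht.2
  have hvI : v ∈ Icc 0 h.lifetime := h.mem_of_mem_visit hτ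
  have h1 := le_antisymm hσ.1 (hσ.2.trans (hatom σ))
  have h2 := le_antisymm hτ.1 (hτ.2.trans (hatom τ))
  have hlt : φ u < φ v := by
    rw [← h1, ← h2, hφ.firstTime_eq hg hmin hmin', hφ.firstTime_eq hg hmin hmin']
    exact hg.lt _ _ (by rw [h1, h2]; exact hv.1)
  exact (hφ.mono hs huI hu.1.le).trans_lt (hlt.trans_le (hφ.mono hvI ht hv.2.le))

end IsLift

/-! ### Existence of a lift, and a second lift at a common atom. -/

/-- The minimal time change: the supremum of the first visit times, for the second coding, of the
points visited before `t` by the first one. -/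
noncomputable def minLift (g : h.Tree ≃ᵢ h'.Tree) (t : ℝ) : ℝ :=
  sSup {u | u = 0 ∨ ∃ σ, h.firstTime σ < t ∧ u = h'.firstTime (g σ)}

section minLift

variable (g)

theorem bddAbove_minLift (t : ℝ) :
    BddAbove {u | u = 0 ∨ ∃ σ, h.firstTime σ < t ∧ u = h'.firstTime (g σ)} := by
  refine ⟨h'.lifetime, ?_⟩
  rintro u (rfl | ⟨σ, -, rfl⟩)
  · exact h'.lifetime_nonneg
  · exact (h'.firstTime_mem _).2

theorem minLift_nonneg (t : ℝ) : 0 ≤ minLift g t :=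
  le_csSup (bddAbove_minLift g t) (Or.inl rfl)

theorem firstTime_le_minLift {σ : h.Tree} {t : ℝ} (hσ : h.firstTime σ < t) :
    h'.firstTime (g σ) ≤ minLift g t :=
  le_csSup (bddAbove_minLift g t) (Or.inr ⟨σ, hσ, rfl⟩)

theorem minLift_le {t c : ℝ} (h0 : 0 ≤ c)
    (hc : ∀ σ, h.firstTime σ < t → h'.firstTime (g σ) ≤ c) : minLift g t ≤ c := by
  refine csSup_le ⟨0, Or.inl rfl⟩ ?_
  rintro u (rfl | ⟨σ, hσ, rfl⟩)
  · exact h0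
  · exact hc σ hσ

theorem minLift_mono : Monotone (minLift g) := fun _ t hst =>
  minLift_le g (minLift_nonneg g t) fun _ hσ => firstTime_le_minLift g (hσ.trans_le hst)

theorem exists_firstTime_gt_of_lt_minLift {t c : ℝ} (h0 : 0 ≤ c) (hc : c < minLift g t) :
    ∃ σ, h.firstTime σ < t ∧ c < h'.firstTime (g σ) := by
  by_contra! hcon
  exact (minLift_le g h0 hcon).not_gt hc

theorem tendsto_minLift (t : ℝ) : Tendsto (minLift g) (𝓝[<] t) (𝓝 (minLift g t)) := by
  refine tendsto_order.2 ⟨fun c hc => ?_, fun c hc => ?_⟩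
  · rcases lt_or_ge c 0 with h0 | h0
    · exact Eventually.of_forall fun s => h0.trans_le (minLift_nonneg g s)
    obtain ⟨σ, hσ, hcσ⟩ := exists_firstTime_gt_of_lt_minLift g h0 hc
    filter_upwards [Ioo_mem_nhdsLT hσ] with s hs
    exact hcσ.trans_le (firstTime_le_minLift g hs.1)
  · filter_upwards [self_mem_nhdsWithin] with s hs
    exact (minLift_mono g (le_of_lt hs)).trans_lt hc

theorem minLift_zero : minLift g 0 = 0 :=
  le_antisymm (minLift_le g le_rfl fun σ hσ => absurd hσ (not_lt.2 (h.firstTime_mem σ).1))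
    (minLift_nonneg g 0)

variable {g}

/-- If some point is the last to be first visited before `t`, then `t` lies in its visit. Otherwise
first visit times accumulate at `t` from the left, as do their images at `minLift g t`, and both
projections are left-continuous. -/
theorem proj_minLift (hg : IsTreeIso g) (hmin : h.IsMinimal) {t : ℝ}
    (ht : t ∈ Icc 0 h.lifetime) : h'.proj (minLift g t) = g (h.proj t) := by
  rcases ht.1.eq_or_lt with h0 | h0
  · rw [← h0, minLift_zero]
    exact hg.map_root.symm
  by_cases hmax : ∃ σ, h.firstTime σ < t ∧ ∀ τ, h.firstTime τ < t → h.firstTime τ ≤ h.firstTime σ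
  · obtain ⟨σ, hσ, hσmax⟩ := hmax
    have h1 : minLift g t = h'.firstTime (g σ) :=
      le_antisymm (minLift_le g (h'.firstTime_mem _).1 fun τ hτ => hg.le (hσmax τ hτ))
        (firstTime_le_minLift g hσ)
    have h2 : t ≤ h.exitTime σ := by
      by_contra! hlt
      obtain ⟨u, hu, τ, hτ⟩ := hmin.exists_visit (h.exitTime_mem σ).1 hlt ht.2
      have h3 := hσmax τ (hτ.1.trans_lt hu.2)
      rcases h3.eq_or_lt with he | hlt'
      · rw [h.firstTime_injective he] at hτ
        exact hu.1.not_ge hτ.2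
      · linarith [h.exitTime_lt_firstTime hlt', h.firstTime_le_exitTime σ, hu.1, hτ.2]
    rw [h1, h'.proj_firstTime, h.proj_eq_of_mem_visit ⟨hσ.le, h2⟩]
  · push Not at hmax
    have hpos : 0 < minLift g t := by
      obtain ⟨τ, hτ, hlt⟩ := hmax h.root (by rwa [h.firstTime_root])
      exact (h'.firstTime_mem _).1.trans_lt
        ((hg.lt _ _ hlt).trans_le (firstTime_le_minLift g hτ))
    -- A visit meeting `(a, t)` may have begun before `a`, but any later point begins after that
    -- visit ends, hence after `a`.
    have hcof : ∀ a < t, ∃ σ, a < h.firstTime σ ∧ h.firstTime σ < t := by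
      intro a ha
      obtain ⟨u, hu, τ, hτ⟩ := hmin.exists_visit (le_max_right a 0) (max_lt ha h0) ht.2
      obtain ⟨κ, hκ, hlt⟩ := hmax τ (hτ.1.trans_lt hu.2)
      refine ⟨κ, ?_, hκ⟩
      linarith [h.exitTime_lt_firstTime hlt, hτ.2, hu.1, le_max_left a 0]
    refine eq_of_forall_dist_le fun ε hε => ?_
    have hev := Metric.tendsto_nhds.1 (h.proj_tendsto_left t) (ε / 2) (half_pos hε)
    have hev' := Metric.tendsto_nhds.1 (h'.proj_tendsto_left (minLift g t)) (ε / 2) (half_pos hε)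
    obtain ⟨a, ha, hab⟩ := mem_nhdsLT_iff_exists_Ioo_subset.1 hev
    obtain ⟨a', ha', hab'⟩ := mem_nhdsLT_iff_exists_Ioo_subset.1 hev'
    obtain ⟨σ₀, hσ₀, hσ₀'⟩ :=
      exists_firstTime_gt_of_lt_minLift g (le_max_right a' 0) (max_lt ha' hpos)
    obtain ⟨σ, hσ, hσt⟩ := hcof (max a (h.firstTime σ₀)) (max_lt ha hσ₀)
    -- The later point `τ` makes `ℓ'(g σ)` strictly smaller than `minLift g t`, as the left
    -- neighbourhood requires.
    obtain ⟨τ, hτt, hστ⟩ := hmax σ hσt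
    have h1 : dist (h.proj (h.firstTime σ)) (h.proj t) < ε / 2 :=
      hab ⟨(le_max_left _ _).trans_lt hσ, hσt⟩
    have h2 : dist (h'.proj (h'.firstTime (g σ))) (h'.proj (minLift g t)) < ε / 2 :=
      hab' ⟨((le_max_left _ _).trans_lt hσ₀').trans (hg.lt _ _ ((le_max_right _ _).trans_lt hσ)),
        (hg.lt _ _ hστ).trans_le (firstTime_le_minLift g hτt)⟩
    rw [h.proj_firstTime, ← g.dist_eq] at h1
    rw [h'.proj_firstTime, dist_comm] at h2
    linarith [dist_triangle (h'.proj (minLift g t)) (g σ) (g (h.proj t))]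

theorem isLift_minLift (hg : IsTreeIso g) (hmin : h.IsMinimal) : IsLift g (minLift g) :=
  ⟨fun t _ => ⟨minLift_nonneg g t,
      minLift_le g h'.lifetime_nonneg fun _ _ => (h'.firstTime_mem _).2⟩,
    (minLift_mono g).monotoneOn _, fun t _ => tendsto_minLift g t, minLift_zero g,
    fun _ ht => proj_minLift hg hmin ht⟩

/-- A common atom gives a second lift: it moves linearly through the visit of the atom, where
`minLift` stays put. -/
theorem exists_isLift_ne_minLift (hg : IsTreeIso g) (hmin : h.IsMinimal) {σ : h.Tree}
    (hσ : h.firstTime σ < h.exitTime σ) (hσ' : h'.firstTime (g σ) < h'.exitTime (g σ)) :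
    ∃ ψ, IsLift g ψ ∧ ¬ EqOn ψ (minLift g) (Icc 0 h.lifetime) := by
  set l := h.firstTime σ with hl
  set r := h.exitTime σ with hr
  set l' := h'.firstTime (g σ) with hl'
  set r' := h'.exitTime (g σ) with hr'
  have hc : 0 < (r' - l') / (r - l) := div_pos (sub_pos.2 hσ') (sub_pos.2 hσ)
  set q : ℝ → ℝ := fun t => min r' (l' + (r' - l') / (r - l) * (t - l)) with hq
  have hqmono : Monotone q := fun s t hst => by
    refine min_le_min le_rfl ?_
    have := mul_le_mul_of_nonneg_left (sub_le_sub_right hst l) hc.le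
    linarith
  have hqcont : Continuous q := by fun_prop
  have hql : ∀ t, l < t → l' < q t := fun t ht => by
    have := mul_pos hc (sub_pos.2 ht)
    exact lt_min hσ' (by linarith)
  have hqr : ∀ t, q t ≤ r' := fun t => min_le_left _ _
  have hlo : ∀ t ∈ Ioc l r, minLift g t = l' := fun t ht =>
    le_antisymm (minLift_le g (h'.firstTime_mem _).1 fun τ hτ => hg.le (by
      by_contra! hlt
      exact ((h.exitTime_lt_firstTime hlt).trans hτ).not_ge ht.2))
      (firstTime_le_minLift g ht.1)
  have hhi : ∀ t ∈ Icc 0 h.lifetime, r < t → r' ≤ minLift g t := by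
    intro t ht hrt
    obtain ⟨u, hu, τ, hτ⟩ := hmin.exists_visit (h.exitTime_mem σ).1 hrt ht.2
    have hστ : h.firstTime σ < h.firstTime τ := by
      by_contra! hle
      rcases hle.eq_or_lt with he | hlt
      · rw [h.firstTime_injective he] at hτ
        exact hu.1.not_ge hτ.2
      · linarith [h.exitTime_lt_firstTime hlt, hu.1, hτ.2]
    exact (h'.exitTime_lt_firstTime (hg.lt _ _ hστ)).le.trans
      (firstTime_le_minLift g (hτ.1.trans_lt hu.2))
  have hrM : r ∈ Icc 0 h.lifetime := h.exitTime_mem σ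
  -- On `(l, r]` the maximum is `q`, since `minLift` equals `l'` there; after `r` it is `minLift`,
  -- which is at least `r'`. Monotonicity and left-continuity pass to the maximum. The two lifts
  -- differ at `r`.
  refine ⟨fun t => if t ≤ l then minLift g t else max (minLift g t) (q t), ⟨?_, ?_, ?_, ?_, ?_⟩,
    fun heq => ?_⟩
  · intro t ht
    have h1 := (isLift_minLift hg hmin).mapsTo ht
    dsimp only
    split_ifs
    · exact h1
    · exact ⟨h1.1.trans (le_max_left _ _),
        max_le h1.2 ((hqr t).trans (h'.exitTime_le_lifetime _))⟩
  · intro s _ t _ hst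
    have h1 := minLift_mono g hst
    dsimp only
    split_ifs with hs ht ht
    · exact h1
    · exact h1.trans (le_max_left _ _)
    · exact absurd (hst.trans ht) hs
    · exact max_le_max h1 (hqmono hst)
  · intro t _
    rcases le_or_gt t l with hlt | hlt
    · rw [if_pos hlt]
      refine (tendsto_minLift g t).congr' ?_
      filter_upwards [self_mem_nhdsWithin] with s hs
      rw [if_pos ((le_of_lt hs).trans hlt)]
    · rw [if_neg hlt.not_ge]
      refine ((tendsto_minLift g t).max (hqcont.continuousWithinAt.tendsto)).congr' ?_
      filter_upwards [Ioo_mem_nhdsLT hlt] with s hs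
      rw [if_neg hs.1.not_ge]
  · rw [if_pos (h.firstTime_mem σ).1, minLift_zero]
  · intro t ht
    rcases le_or_gt t l with hlt | hlt
    · rw [if_pos hlt, proj_minLift hg hmin ht]
    rw [if_neg hlt.not_ge]
    rcases le_or_gt t r with htr | htr
    · rw [hlo t ⟨hlt, htr⟩, max_eq_right (hql t hlt).le,
        h'.proj_eq_of_mem_visit ⟨(hql t hlt).le, hqr t⟩,
        h.proj_eq_of_mem_visit ⟨hlt.le, htr⟩]
    · rw [max_eq_left ((hqr t).trans (hhi t ht htr)), proj_minLift hg hmin ht]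
  · have := heq hrM
    dsimp only at this
    rw [if_neg hσ.not_ge, hlo r ⟨hσ, le_rfl⟩, max_eq_right (hql r hσ).le] at this
    exact (hql r hσ).ne this.symm

end minLift

end HeightFunction

/-! ### Transfer to the structured tree. -/

theorem theorem2 {T : Type*} [MetricSpace T] [CompactSpace T] [LinearOrder T]
    [MeasurableSpace T] [BorelSpace T] (hT : IsRealTree T) (ρ : T)
    (hOr1 : Or1 ρ) (hOr2 : Or2 ρ)
    (μ μ' : Measure T) [IsFiniteMeasure μ] [IsFiniteMeasure μ'] (hμ : Mes μ) (hμ' : Mes μ')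
    (h h' : HeightFunction) (hmin : h.IsMinimal) (hmin' : h'.IsMinimal)
    (hcode : h.Codes ρ μ) (hcode' : h'.Codes ρ μ') :
    h.lifetime = μ.real univ ∧ h'.lifetime = μ'.real univ ∧
    (∃ φ : ℝ → ℝ, h.IsTimeChange h' φ) ∧
    ((∀ φ ψ : ℝ → ℝ, h.IsTimeChange h' φ → h.IsTimeChange h' ψ →
        EqOn φ ψ (Icc 0 h.lifetime)) ↔
      ∀ σ : T, μ {σ} * μ' {σ} = 0) ∧
    ∀ φ : ℝ → ℝ, h.IsTimeChange h' φ →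
      ((∀ σ : T, μ' {σ} = 0) → ContinuousOn φ (Icc 0 h.lifetime)) ∧
      ((∀ σ : T, μ {σ} = 0) → StrictMonoOn φ (Icc 0 h.lifetime)) ∧
      ∀ t ∈ Ico 0 h.lifetime, ∃ b : ℝ, Tendsto φ (𝓝[>] t) (𝓝 b) ∧
        (φ t < b → ∀ u ∈ Icc (φ t) b, h'.toFun u = h.toFun t) := by
  obtain ⟨f, hfρ, hfle, hfμ⟩ := hcode
  obtain ⟨f', hfρ', hfle', hfμ'⟩ := hcode'
  have : CompactSpace h.Tree := f.toHomeomorph.compactSpace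
  set g : h.Tree ≃ᵢ h'.Tree := f.symm.trans f' with hgdef
  have hgf : ∀ a, g (f a) = f' a := fun a => congrArg f' (f.symm_apply_apply a)
  have hg : HeightFunction.IsTreeIso g := by
    refine ⟨by rw [← hfρ, hgf, hfρ'], fun σ τ hστ => ?_⟩
    obtain ⟨a, rfl⟩ := f.surjective σ
    obtain ⟨b, rfl⟩ := f.surjective τ
    rw [hgf, hgf]
    have hab : a < b := not_le.1 fun hle => (hfle _ _ hle).not_gt hστ
    exact lt_of_le_of_ne (hfle' _ _ hab.le) fun he =>
      hab.ne (f'.injective (h'.firstTime_injective he))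
  -- Atoms of `μ` and `μ'` are read off as lengths of visits, the form in which the results on lifts
  -- are stated.
  have hatom : ∀ a, μ {a} = ENNReal.ofReal (h.exitTime (f a) - h.firstTime (f a)) := fun a => by
    rw [← hmin.treeMeasure_singleton, hfμ,
      Measure.map_apply f.continuous.measurable (measurableSet_singleton _),
      ← image_singleton, preimage_image_eq _ f.injective]
  have hatom' : ∀ a, μ' {a} = ENNReal.ofReal (h'.exitTime (f' a) - h'.firstTime (f' a)) :=
    fun a => by
      rw [← hmin'.treeMeasure_singleton, hfμ',
        Measure.map_apply f'.continuous.measurable (measurableSet_singleton _),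
        ← image_singleton, preimage_image_eq _ f'.injective]
  have hlift := HeightFunction.isLift_minLift hg hmin
  refine ⟨?_, ?_, ⟨_, hlift.isTimeChange hg⟩, ⟨fun huniq a => ?_, fun hzero φ ψ hφ hψ => ?_⟩,
    fun φ hφ => ⟨fun hzero => ?_, fun hzero => ?_, fun t ht => ?_⟩⟩
  · rw [Measure.real, ← preimage_univ (f := f), ← Measure.map_apply f.continuous.measurable
      MeasurableSet.univ, ← hfμ, HeightFunction.treeMeasure_univ,
      ENNReal.toReal_ofReal h.lifetime_nonneg]
  · rw [Measure.real, ← preimage_univ (f := f'), ← Measure.map_apply f'.continuous.measurable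
      MeasurableSet.univ, ← hfμ', HeightFunction.treeMeasure_univ,
      ENNReal.toReal_ofReal h'.lifetime_nonneg]
  · by_contra hne
    rw [hatom, hatom', mul_eq_zero, not_or, ENNReal.ofReal_eq_zero, ENNReal.ofReal_eq_zero,
      sub_nonpos, sub_nonpos, not_le, not_le, ← hgf] at hne
    obtain ⟨ψ, hψ, hneq⟩ := HeightFunction.exists_isLift_ne_minLift hg hmin hne.1 hne.2
    exact hneq (huniq _ _ (hψ.isTimeChange hg) (hlift.isTimeChange hg))
  · refine (hφ.isLift hg).eqOn_of_no_common_atom (hψ.isLift hg) hg hmin hmin' fun σ => ?_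
    obtain ⟨a, rfl⟩ := f.surjective σ
    have := hzero a
    rwa [hatom, hatom', mul_eq_zero, ENNReal.ofReal_eq_zero, ENNReal.ofReal_eq_zero,
      sub_nonpos, sub_nonpos, ← hgf] at this
  · refine (hφ.isLift hg).continuousOn hg hmin hmin' fun τ => ?_
    obtain ⟨a, rfl⟩ := f'.surjective τ
    have := hzero a
    rwa [hatom', ENNReal.ofReal_eq_zero, sub_nonpos] at this
  · refine (hφ.isLift hg).strictMonoOn hg hmin hmin' fun σ => ?_
    obtain ⟨a, rfl⟩ := f.surjective σ
    have := hzero a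
    rwa [hatom, ENNReal.ofReal_eq_zero, sub_nonpos] at this
  · obtain ⟨b, hlim, -, hbM, hb⟩ := (hφ.isLift hg).exists_rightLim ht
    exact ⟨b, hlim, fun hlt u hu =>
      (hφ.isLift hg).toFun_eq_of_mem_jump hg hmin hmin' ⟨ht.1, ht.2.le⟩ hlt hbM hb hu⟩
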